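/- Let $\phi=\frac{1+\sqrt5}{2}$ and let $x_n=\{n\phi\}$ for $n\ge 1$, where $\{z\}=z-\lfloor z\rfloor$. For $x\in\mathbb R$ write $\|x\|=\min(x-\lfloor x\rfloor,\,1-(x-\lfloor x\rfloor))$ for the distance to the nearest integer, and for $\alpha\in(0,1]$, $s>0$ and $N\ge1$ put $$F_N^\alpha(s)=\frac{1}{N^{2-\alpha}}\,\#\Big\{(l,m): 1\le l\ne m\le N,\ \|x_l-x_m\|\le \frac{s}{N^\alpha}\Big\}.$$ The sequence $(x_n)$ has $\alpha$-pair correlations if $\lim_{N\to\infty}F_N^\alpha(s)=2s$ for every $s>0$, and Poissonian pair correlations if this holds with $\alpha=1$. **Theorem.** The golden-mean Kronecker sequence $(x_n)=(\{n\phi\})_{n\ge1}$ has $\alpha$-pair correlations for every $0<\alpha<1$, but it does not have Poissonian pair correlations. Moreover, let $q_1=1,\ q_2=1,\ q_3=2,\ q_4=3,\dots$ be the successive denominators of the convergents of the continued fraction $\phi=[1;1,1,1,\dots]$; then for every $h\ge1$, $q_h$ is the $h$-th Fibonacci number, every pair $1\le l\ne m\le q_h$ satisfies $\|x_l-x_m\|>\frac{1}{2q_h}$,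 and consequently $F^1_{q_h}(\tfrac12)=0$. -/

import Mathlib

noncomputable section

/-- The distance `‖x‖ = min ({x}, 1 - {x})` of a real number `x` to the nearest integer. -/
def circleNorm (x : ℝ) : ℝ :=
  min (x - ⌊x⌋) (1 - (x - ⌊x⌋))

/-- The number of ordered pairs `(l, m)` with `1 ≤ l ≠ m ≤ N` and `‖x_l - x_m‖ ≤ r`. -/
def closePairs (x : ℕ → ℝ) (N : ℕ) (r : ℝ) : ℕ :=
  Set.ncard {p : ℕ × ℕ | (1 ≤ p.1 ∧ p.1 ≤ N) ∧ (1 ≤ p.2 ∧ p.2 ≤ N) ∧ p.1 ≠ p.2 ∧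
    circleNorm (x p.1 - x p.2) ≤ r}

/-- The pair correlation statistic `F_N^α(s)` of the sequence `x_1, x_2, …`. -/
def pairCorrelation (x : ℕ → ℝ) (α : ℝ) (N : ℕ) (s : ℝ) : ℝ :=
  1 / (N : ℝ) ^ (2 - α) * (closePairs x N (s / (N : ℝ) ^ α) : ℝ)

/-- A sequence `x_1, x_2, …` in `[0, 1)` has `α`-pair correlations (where `0 < α ≤ 1`) if
`F_N^α(s) → 2 s` as `N → ∞`, for every `s > 0`. -/
def HasPairCorrelations (α : ℝ) (x : ℕ → ℝ) : Prop :=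
  ∀ s : ℝ, 0 < s →
    Filter.Tendsto (fun N : ℕ => pairCorrelation x α N s) Filter.atTop (nhds (2 * s))

/-- A sequence `x_1, x_2, …` in `[0, 1)` has Poissonian pair correlations. -/
def HasPoissonianPairCorrelations (x : ℕ → ℝ) : Prop :=
  ∀ s : ℝ, 0 < s →
    Filter.Tendsto (fun N : ℕ => 1 / (N : ℝ) * (closePairs x N (s / (N : ℝ)) : ℝ))
      Filter.atTop (nhds (2 * s))

/-- The Kronecker sequence `({n z})_n`. -/
def kroneckerSeq (z : ℝ) (n : ℕ) : ℝ :=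
  Int.fract ((n : ℝ) * z)

end

open Real Filter Topology

/-! Separation: for 0 < d < F_{k+1}, every integer is at distance at least φ^{-k} > 1/(2F_{k+1})
from dφ. So for N = F_{k+1} no pair is within 1/(2N), and the Poissonian limit fails at s = 1/2. For
α < 1, the number of j < N with jφ within r < 1/2 of y mod 1 is 2rN + O(log N), uniformly in y
(`abs_hitCount_sub_le_log`): a block of Fibonacci length q is nearly a shift of the multiples of
1/q, so its error is at most 3, and N splits greedily into O(log N) blocks. Summing over centres lφ
gives 2rN² + O(N log N) pairs; with r = s/N^α the normalised error is O(log N / N^{1-α}). -/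

theorem circleNorm_eq_abs_sub_round (x : ℝ) : circleNorm x = |x - round x| := by
  rw [abs_sub_round_eq_min]
  rfl

theorem circleNorm_le_iff {x r : ℝ} : circleNorm x ≤ r ↔ ∃ t : ℤ, |x - t| ≤ r := by
  rw [circleNorm_eq_abs_sub_round]
  exact ⟨fun h => ⟨_, h⟩, fun ⟨t, ht⟩ => (round_le x t).trans ht⟩

theorem circleNorm_kroneckerSeq_sub_le_iff {z r : ℝ} {l m : ℕ} :
    circleNorm (kroneckerSeq z l - kroneckerSeq z m) ≤ r ↔
      ∃ t : ℤ, |(m : ℝ) * z - l * z - t| ≤ r := by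
  rw [circleNorm_le_iff]
  unfold kroneckerSeq Int.fract
  constructor
  · rintro ⟨t, ht⟩
    refine ⟨⌊(m : ℝ) * z⌋ - ⌊(l : ℝ) * z⌋ - t, ?_⟩
    rw [← abs_neg]
    convert ht using 2
    push_cast
    ring
  · rintro ⟨t, ht⟩
    refine ⟨⌊(m : ℝ) * z⌋ - ⌊(l : ℝ) * z⌋ - t, ?_⟩
    rw [← abs_neg]
    convert ht using 2
    push_cast
    ring

/-! ### Fibonacci separation of the points -/

section Separation

/-- Matrices of consecutive Fibonacci numbers have determinant ±1, so their rows form a basis of ℤ².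
-/
theorem exists_fib_coordinates (k : ℕ) (p d : ℤ) :
    ∃ a b : ℤ, d = a * Nat.fib k + b * Nat.fib (k + 1) ∧
      p = a * Nat.fib (k + 1) + b * Nat.fib (k + 2) := by
  induction k with
  | zero => exact ⟨p - d, d, by simp, by simp⟩
  | succ k ih =>
    obtain ⟨a, b, hd, hp⟩ := ih
    refine ⟨b - a, a, ?_, ?_⟩
    · rw [hd, Nat.fib_add_two (n := k)]
      push_cast
      ring
    · rw [hp, Nat.fib_add_two (n := k + 1)]
      push_cast
      ring

/-- With ψ the conjugate of φ, p - dφ = ψ^k (a + bψ). The range of d forces a ≠ 0 and b zero or of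
opposite sign; as ψ < 0, the two terms do not cancel and |a + bψ| ≥ |a| ≥ 1. -/
theorem abs_goldenConj_pow_le_abs_sub {k : ℕ} {p d : ℤ} (hd : 0 < d) (hdk : d < Nat.fib (k + 1)) :
    |goldenConj| ^ k ≤ |(p : ℝ) - d * goldenRatio| := by
  obtain ⟨a, b, rfl, rfl⟩ := exists_fib_coordinates k p d
  have h1 := fib_succ_sub_goldenRatio_mul_fib k
  have h2 := fib_succ_sub_goldenRatio_mul_fib (k + 1)
  have key : (((a * Nat.fib (k + 1) + b * Nat.fib (k + 2) : ℤ)) : ℝ)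
      - ((a * Nat.fib k + b * Nat.fib (k + 1) : ℤ) : ℝ) * goldenRatio
      = goldenConj ^ k * (a + b * goldenConj) := by
    push_cast
    linear_combination a * h1 + b * h2
  rw [key, abs_mul, abs_pow]
  have hf : (0 : ℤ) ≤ Nat.fib k := Int.natCast_nonneg _
  have hf' : (0 : ℤ) ≤ Nat.fib (k + 1) := Int.natCast_nonneg _
  refine le_mul_of_one_le_right (by positivity) ?_
  have hψ := goldenConj_neg
  rcases lt_trichotomy a 0 with ha | ha | ha
  · have hb : 0 ≤ b := by
      by_contra! hb
      nlinarith
    have ha' : (a : ℝ) ≤ -1 := by exact_mod_cast (by omega : a ≤ -1)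
    have hb' : (0 : ℝ) ≤ b := by exact_mod_cast hb
    rw [le_abs]
    right
    nlinarith
  · subst ha
    have hb : 0 < b := by
      by_contra! hb
      nlinarith
    nlinarith
  · have hb : b ≤ 0 := by
      by_contra! hb
      nlinarith
    have ha' : (1 : ℝ) ≤ a := by exact_mod_cast ha
    have hb' : (b : ℝ) ≤ 0 := by exact_mod_cast hb
    rw [le_abs]
    left
    nlinarith

theorem goldenRatio_pow_lt_two_mul_fib (k : ℕ) :
    goldenRatio ^ k < 2 * Nat.fib (k + 1) := by
  induction k using Nat.twoStepInduction with
  | zero => norm_num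
  | one => simpa using goldenRatio_lt_two
  | more k h1 h2 =>
    have := goldenRatio_pow_sub_goldenRatio_pow k
    rw [Nat.fib_add_two]
    push_cast
    linarith

theorem fib_succ_le_goldenRatio_pow (k : ℕ) : (Nat.fib (k + 1) : ℝ) ≤ goldenRatio ^ k := by
  induction k using Nat.twoStepInduction with
  | zero => norm_num
  | one => simpa using one_lt_goldenRatio.le
  | more k h1 h2 =>
    have := goldenRatio_pow_sub_goldenRatio_pow k
    rw [Nat.fib_add_two]
    push_cast
    linarith

theorem abs_goldenConj : |goldenConj| = goldenRatio⁻¹ := by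
  rw [abs_of_neg goldenConj_neg, inv_goldenRatio]

theorem one_div_two_mul_fib_lt_circleNorm {k l m : ℕ} (hl1 : 1 ≤ l) (hl : l ≤ Nat.fib (k + 1))
    (hm1 : 1 ≤ m) (hm : m ≤ Nat.fib (k + 1)) (hlm : l ≠ m) :
    1 / (2 * (Nat.fib (k + 1) : ℝ)) <
      circleNorm (kroneckerSeq goldenRatio l - kroneckerSeq goldenRatio m) := by
  have hlt : 1 / (2 * (Nat.fib (k + 1) : ℝ)) < |goldenConj| ^ k := by
    rw [abs_goldenConj, inv_pow, one_div]
    exact inv_strictAnti₀ (pow_pos goldenRatio_pos k) (goldenRatio_pow_lt_two_mul_fib k)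
  refine hlt.trans_le ?_
  by_contra! h
  obtain ⟨r, hr, hr'⟩ := exists_between h
  obtain ⟨t, ht⟩ := circleNorm_kroneckerSeq_sub_le_iff.1 hr.le
  rcases lt_or_gt_of_ne hlm with hlt | hlt
  · have := abs_goldenConj_pow_le_abs_sub (k := k) (p := t) (d := (m : ℤ) - l)
      (by omega) (by omega)
    rw [abs_sub_comm] at this
    push_cast at this
    rw [sub_mul] at this
    linarith
  · have := abs_goldenConj_pow_le_abs_sub (k := k) (p := -t) (d := (l : ℤ) - m)
      (by omega) (by omega)
    have e : ((-t : ℤ) : ℝ) - ((l : ℤ) - m : ℤ) * goldenRatio =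
      (m : ℝ) * goldenRatio - l * goldenRatio - t := by push_cast; ring
    rw [e] at this
    linarith

theorem pairCorrelation_one_fib (k : ℕ) :
    pairCorrelation (kroneckerSeq goldenRatio) 1 (Nat.fib (k + 1)) (1 / 2) = 0 := by
  have : closePairs (kroneckerSeq goldenRatio) (Nat.fib (k + 1))
      (1 / 2 / (Nat.fib (k + 1) : ℝ) ^ (1 : ℝ)) = 0 := by
    unfold closePairs
    convert Set.ncard_empty (ℕ × ℕ)
    refine Set.eq_empty_of_forall_notMem ?_
    rintro ⟨l, m⟩ ⟨⟨hl1, hl⟩, ⟨hm1, hm⟩, hne, hle⟩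
    have := one_div_two_mul_fib_lt_circleNorm hl1 hl hm1 hm hne
    rw [rpow_one, div_div] at hle
    exact absurd this hle.not_gt
  unfold pairCorrelation
  rw [this]
  simp

end Separation

/-! ### Convergent denominators of φ -/

section Convergents

theorem floor_goldenRatio : ⌊goldenRatio⌋ = 1 := by
  rw [Int.floor_eq_iff]
  have := one_lt_goldenRatio
  have := goldenRatio_lt_two
  constructor <;> norm_num <;> linarith

theorem inv_goldenRatio_sub_one : (goldenRatio - 1)⁻¹ = goldenRatio := by
  rw [inv_eq_iff_eq_inv, inv_goldenRatio]
  linarith [one_sub_goldenRatio]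

/-- Every complete quotient is φ again, because 1/(φ - 1) = φ. -/
theorem intFractPair_stream_goldenRatio (n : ℕ) :
    GenContFract.IntFractPair.stream goldenRatio n = some ⟨1, goldenRatio - 1⟩ := by
  have hof : GenContFract.IntFractPair.of goldenRatio = ⟨1, goldenRatio - 1⟩ := by
    simp [GenContFract.IntFractPair.of, Int.fract, floor_goldenRatio]
  induction n with
  | zero => rw [GenContFract.IntFractPair.stream_zero, hof]
  | succ n ih =>
    rw [GenContFract.IntFractPair.stream_succ_of_some ih
      (by simpa using (sub_pos.2 one_lt_goldenRatio).ne'), inv_goldenRatio_sub_one, hof]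

theorem dens_goldenRatio (n : ℕ) :
    (GenContFract.of goldenRatio).dens n = (Nat.fib (n + 1) : ℝ) := by
  have hs (n : ℕ) : (GenContFract.of goldenRatio).s.get? n = some ⟨1, 1⟩ := by
    simpa using GenContFract.get?_of_eq_some_of_succ_get?_intFractPair_stream
      (intFractPair_stream_goldenRatio (n + 1))
  induction n using Nat.twoStepInduction with
  | zero => simp [GenContFract.zeroth_den_eq_one]
  | one => simp [GenContFract.first_den_eq (hs 0)]
  | more n h1 h2 =>
    rw [GenContFract.dens_recurrence (hs (n + 1)) h1 h2, Nat.fib_add_two (n := n + 1)]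
    push_cast
    ring

end Convergents

/-! ### Logarithmic discrepancy -/

section Equidistribution

open Classical in
/-- The number of `0 ≤ j < N` with `j φ` within `r` of `y` modulo one. -/
noncomputable def hitCount (N : ℕ) (y r : ℝ) : ℕ :=
  ((Finset.range N).filter fun j : ℕ => ∃ t : ℤ, |(j : ℝ) * goldenRatio - y - t| ≤ r).card

/-- Cutting off a block translates the target, hence the need for bounds uniform in y. -/
theorem hitCount_add (M N : ℕ) (y r : ℝ) :
    hitCount (M + N) y r = hitCount M y r + hitCount N (y - M * goldenRatio) r := by
  classical
  unfold hitCount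
  simp only [Finset.card_filter, Finset.sum_range_add]
  congr 1
  refine Finset.sum_congr rfl fun j _ => ?_
  have (t : ℤ) : ((M + j : ℕ) : ℝ) * goldenRatio - y - t =
      (j : ℝ) * goldenRatio - (y - M * goldenRatio) - t := by push_cast; ring
  simp only [this]

theorem abs_mul_goldenRatio_sub_div_le {n j : ℕ} (hn : 1 ≤ n) (hj : j < Nat.fib n) :
    |(j : ℝ) * goldenRatio - j * Nat.fib (n + 1) / Nat.fib n| ≤ 1 / Nat.fib n := by
  have hq : (0 : ℝ) < Nat.fib n := by exact_mod_cast Nat.fib_pos.2 hn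
  have h := fib_succ_sub_goldenRatio_mul_fib n
  have e : (j : ℝ) * goldenRatio - j * Nat.fib (n + 1) / Nat.fib n =
      -(j * goldenConj ^ n / Nat.fib n) := by
    field_simp
    linear_combination -2 * (j : ℝ) * h
  rw [e, abs_neg, abs_div, abs_of_pos hq]
  refine div_le_div_of_nonneg_right ?_ hq.le
  rw [abs_mul, abs_pow, abs_goldenConj, inv_pow, Nat.abs_cast,
    mul_inv_le_iff₀ (pow_pos goldenRatio_pos n), one_mul]
  have h1 : (j : ℝ) ≤ Nat.fib n := by exact_mod_cast hj.le
  have h2 : (Nat.fib n : ℝ) ≤ Nat.fib (n + 1) := by exact_mod_cast Nat.fib_le_fib_succ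
  exact h1.trans (h2.trans (fib_succ_le_goldenRatio_pow n))

theorem card_Icc_ceil_floor_le {a b : ℝ} (h : a ≤ b) :
    ((Finset.Icc ⌈a⌉ ⌊b⌋).card : ℝ) ≤ b - a + 1 := by
  have h1 := Int.floor_le b
  have h2 := Int.le_ceil a
  rw [Int.card_Icc]
  rcases le_total 0 (⌊b⌋ + 1 - ⌈a⌉) with h0 | h0
  · rw [← Int.cast_natCast, Int.toNat_of_nonneg h0]
    push_cast
    linarith
  · rw [Int.toNat_of_nonpos h0]
    push_cast
    linarith

theorem sub_one_lt_card_Icc_ceil_floor (a b : ℝ) :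
    b - a - 1 < ((Finset.Icc ⌈a⌉ ⌊b⌋).card : ℝ) := by
  have h1 := Int.lt_floor_add_one b
  have h2 := Int.ceil_lt_add_one a
  have h3 : ((⌊b⌋ + 1 - ⌈a⌉ : ℤ) : ℝ) ≤ ((⌊b⌋ + 1 - ⌈a⌉).toNat : ℤ) := by
    exact_mod_cast Int.self_le_toNat _
  rw [Int.card_Icc]
  push_cast at h3
  linarith

/-- A hit j yields an integer k ≡ jF_{n+1} mod q in an interval of length 2rq + 2, and k determines
j by coprimality. -/
theorem hitCount_fib_le {n : ℕ} (hn : 1 ≤ n) (y : ℝ) {r : ℝ} (hr : 0 ≤ r) :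
    (hitCount (Nat.fib n) y r : ℝ) ≤ 2 * r * Nat.fib n + 3 := by
  classical
  have hq0 := Nat.fib_pos.2 hn
  set q := Nat.fib n with hq
  have hq' : (0 : ℝ) < q := by exact_mod_cast hq0
  have hcop : IsCoprime (q : ℤ) (Nat.fib (n + 1) : ℤ) :=
    Nat.isCoprime_iff_coprime.2 (Nat.fib_coprime_fib_succ n)
  have hle : hitCount q y r ≤
      -- The margin 1 is q times the approximation error 1/q.
      (Finset.Icc ⌈q * (y - r) - 1⌉ ⌊q * (y + r) + 1⌋).card := by
    unfold hitCount
    refine Finset.card_le_card_of_forall_subsingleton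
      (fun (j : ℕ) (k : ℤ) => (q : ℤ) ∣ k - j * Nat.fib (n + 1)) ?_ ?_
    · intro j hj
      simp only [Finset.mem_filter, Finset.mem_range] at hj
      obtain ⟨hj, t, ht⟩ := hj
      refine ⟨j * Nat.fib (n + 1) - t * q, ?_, ⟨-t, by ring⟩⟩
      have hclose := abs_le.1 (abs_mul_goldenRatio_sub_div_le hn hj)
      rw [← hq] at hclose
      have ht := abs_le.1 ht
      have e : (j : ℝ) * Nat.fib (n + 1) / q * q = j * Nat.fib (n + 1) := by field_simp
      have e1 : 1 / (q : ℝ) * q = 1 := by field_simp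
      rw [Finset.mem_Icc, Int.ceil_le, Int.le_floor]
      push_cast
      constructor <;> nlinarith
    · intro k _ j hj j' hj'
      simp only [Finset.mem_filter, Finset.mem_range, Set.mem_ofPred_eq] at hj hj'
      have hdvd : (q : ℤ) ∣ ((j : ℤ) - j') * Nat.fib (n + 1) := by
        rw [show ((j : ℤ) - j') * Nat.fib (n + 1) =
          (k - j' * Nat.fib (n + 1)) - (k - j * Nat.fib (n + 1)) by ring]
        exact dvd_sub hj'.2 hj.2
      have := Int.eq_zero_of_abs_lt_dvd (hcop.dvd_of_dvd_mul_right hdvd)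
        (by have := hj.1.1; have := hj'.1.1; rw [abs_lt]; omega)
      omega
  have h2 := card_Icc_ceil_floor_le (a := q * (y - r) - 1) (b := q * (y + r) + 1) (by nlinarith)
  have h3 : (hitCount q y r : ℝ) ≤ _ := Nat.cast_le.2 hle
  linarith

/-- Conversely, each k in the interval shrunk by 1 at both ends yields a hit j ≡ ku mod q, u being
the inverse of F_{n+1}. Since r < 1/2, the interval is shorter than q, so distinct k give distinct
j. -/
theorem le_hitCount_fib {n : ℕ} (hn : 1 ≤ n) (y : ℝ) {r : ℝ} (hr : r < 1 / 2) :
    2 * r * Nat.fib n - 3 ≤ (hitCount (Nat.fib n) y r : ℝ) := by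
  classical
  have hq0 := Nat.fib_pos.2 hn
  set q := Nat.fib n with hq
  have hq' : (0 : ℝ) < q := by exact_mod_cast hq0
  have hcop : IsCoprime (Nat.fib (n + 1) : ℤ) (q : ℤ) :=
    (Nat.isCoprime_iff_coprime.2 (Nat.fib_coprime_fib_succ n)).symm
  obtain ⟨u, v, huv⟩ := hcop
  have hle : (Finset.Icc ⌈q * (y - r) + 1⌉ ⌊q * (y + r) - 1⌋).card ≤ hitCount q y r := by
    unfold hitCount
    refine Finset.card_le_card_of_forall_subsingleton
      (fun (k : ℤ) (j : ℕ) => (q : ℤ) ∣ j * Nat.fib (n + 1) - k) ?_ ?_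
    · intro k hk
      rw [Finset.mem_Icc, Int.ceil_le, Int.le_floor] at hk
      have hqz : (0 : ℤ) < q := by exact_mod_cast hq0
      obtain ⟨j, hj⟩ := Int.eq_ofNat_of_zero_le (Int.emod_nonneg (k * u) hqz.ne')
      have hjq : j < q := by
        have := Int.emod_lt_of_pos (k * u) hqz
        omega
      have hdiv := Int.emod_add_mul_ediv (k * u) q
      rw [hj] at hdiv
      have ht : (j : ℤ) * Nat.fib (n + 1) - k =
          q * (-(k * u / q) * Nat.fib (n + 1) - k * v) := by
        linear_combination (Nat.fib (n + 1) : ℤ) * hdiv + k * huv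
      refine ⟨j, ?_, ⟨_, ht⟩⟩
      generalize -(k * u / q) * (Nat.fib (n + 1) : ℤ) - k * v = t at ht
      simp only [Finset.mem_filter, Finset.mem_range]
      refine ⟨hjq, t, ?_⟩
      have hclose := abs_le.1 (abs_mul_goldenRatio_sub_div_le hn hjq)
      rw [← hq] at hclose
      have ht' : (j : ℝ) * Nat.fib (n + 1) - k = q * t := by exact_mod_cast ht
      have e : (j : ℝ) * Nat.fib (n + 1) / q = t + k / q := by
        field_simp
        linarith
      have e1 : y - r + 1 / q ≤ k / q := by
        rw [le_div_iff₀ hq', add_mul, div_mul_cancel₀ _ hq'.ne']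
        linarith [hk.1]
      have e2 : (k : ℝ) / q ≤ y + r - 1 / q := by
        rw [div_le_iff₀ hq', sub_mul, div_mul_cancel₀ _ hq'.ne']
        linarith [hk.2]
      rw [abs_le]
      constructor <;> linarith
    · intro j _ k hk k' hk'
      simp only [Finset.mem_Icc, Int.ceil_le, Int.le_floor, Set.mem_ofPred_eq] at hk hk'
      have hdvd : (q : ℤ) ∣ k - k' := by
        rw [show k - k' = (j * Nat.fib (n + 1) - k') - (j * Nat.fib (n + 1) - k) by ring]
        exact dvd_sub hk'.2 hk.2
      have : |k - k'| < q := by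
        have : |(k : ℝ) - k'| < q := by
          rw [abs_lt]
          constructor <;> nlinarith
        exact_mod_cast this
      have := Int.eq_zero_of_abs_lt_dvd hdvd this
      omega
  have h2 := sub_one_lt_card_Icc_ceil_floor (q * (y - r) + 1) (q * (y + r) - 1)
  have h3 : _ ≤ (hitCount q y r : ℝ) := Nat.cast_le.2 hle
  linarith

theorem abs_hitCount_sub_le {r : ℝ} (hr0 : 0 ≤ r) (hr : r < 1 / 2) (k : ℕ) {N : ℕ}
    (hN : N < Nat.fib (k + 1)) (y : ℝ) : |(hitCount N y r : ℝ) - 2 * r * N| ≤ 3 * k := by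
  induction k generalizing N y with
  | zero =>
    obtain rfl : N = 0 := by simpa using hN
    simp [hitCount]
  | succ k ih =>
    push_cast
    rcases lt_or_ge N (Nat.fib (k + 1)) with h | h
    · linarith [ih h y]
    · obtain ⟨N, rfl⟩ := Nat.exists_eq_add_of_le h
      -- After removing a block of length F_{k+1}, fewer than F_k points remain; each block costs 3.
      have hlt : N < Nat.fib (k + 1) := by
        rw [Nat.fib_add_two] at hN
        have := Nat.fib_le_fib_succ (n := k)
        omega
      have h1 := hitCount_fib_le (Nat.le_add_left 1 k) y hr0
      have h2 := le_hitCount_fib (Nat.le_add_left 1 k) y hr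
      have h3 := abs_le.1 (ih hlt (y - Nat.fib (k + 1) * goldenRatio))
      rw [hitCount_add, abs_le]
      push_cast
      constructor <;> nlinarith

/-- Fibonacci numbers at least double every two steps. -/
theorem lt_fib_two_mul_log (N : ℕ) : N < Nat.fib (2 * Nat.log 2 N + 3 + 1) := by
  have h (j : ℕ) : 2 ^ (j + 1) ≤ Nat.fib (2 * j + 4) := by
    induction j with
    | zero => decide
    | succ j ih =>
      have h1 := Nat.fib_add_two (n := 2 * j + 4)
      have h2 := Nat.fib_le_fib_succ (n := 2 * j + 4)
      rw [show 2 * (j + 1) + 4 = 2 * j + 4 + 2 by ring, pow_succ]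
      omega
  exact (Nat.lt_pow_succ_log_self one_lt_two N).trans_le (h _)

theorem abs_hitCount_sub_le_log {r : ℝ} (hr0 : 0 ≤ r) (hr : r < 1 / 2) (N : ℕ) (y : ℝ) :
    |(hitCount N y r : ℝ) - 2 * r * N| ≤ 3 * (2 * logb 2 N + 3) := by
  refine (abs_hitCount_sub_le hr0 hr _ (lt_fib_two_mul_log N) y).trans ?_
  have := natLog_le_logb N 2
  push_cast at this ⊢
  linarith

end Equidistribution

/-! ### From discrepancy to pair correlations -/

section PairCorrelations

/-- The extra N counts the diagonal l = m, always a hit as r ≥ 0. -/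
theorem closePairs_add_self {N : ℕ} {r : ℝ} (hr : 0 ≤ r) :
    closePairs (kroneckerSeq goldenRatio) N r + N =
      ∑ l ∈ Finset.range N, hitCount N (l * goldenRatio) r := by
  classical
  have hset : {p : ℕ × ℕ | (1 ≤ p.1 ∧ p.1 ≤ N) ∧ (1 ≤ p.2 ∧ p.2 ≤ N) ∧ p.1 ≠ p.2 ∧
      circleNorm (kroneckerSeq goldenRatio p.1 - kroneckerSeq goldenRatio p.2) ≤ r} =
      (fun p : ℕ × ℕ => (p.1 + 1, p.2 + 1)) ''
        ((((Finset.range N ×ˢ Finset.range N).filter fun p =>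
          ∃ t : ℤ, |(p.2 : ℝ) * goldenRatio - p.1 * goldenRatio - t| ≤ r).filter
            fun p => p.1 ≠ p.2 : Finset (ℕ × ℕ)) : Set (ℕ × ℕ)) := by
    have hshift (l m : ℕ) (t : ℤ) : ((m + 1 : ℕ) : ℝ) * goldenRatio - (l + 1 : ℕ) * goldenRatio - t
        = (m : ℝ) * goldenRatio - l * goldenRatio - t := by push_cast; ring
    ext ⟨l, m⟩
    simp only [circleNorm_kroneckerSeq_sub_le_iff, Set.mem_ofPred_eq, Set.mem_image,
      Finset.coe_filter, Finset.mem_filter, Finset.mem_product, Finset.mem_range, Prod.mk.injEq,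
      Prod.exists]
    constructor
    · rintro ⟨⟨hl1, hl⟩, ⟨hm1, hm⟩, hne, ht⟩
      obtain ⟨l, rfl⟩ := Nat.exists_eq_add_of_le' hl1
      obtain ⟨m, rfl⟩ := Nat.exists_eq_add_of_le' hm1
      simp only [hshift] at ht
      exact ⟨l, m, ⟨⟨⟨by omega, by omega⟩, ht⟩, by omega⟩, rfl, rfl⟩
    · rintro ⟨l, m, ⟨⟨⟨hl, hm⟩, ht⟩, hne⟩, rfl, rfl⟩
      simp only [hshift]
      exact ⟨⟨by omega, by omega⟩, ⟨by omega, by omega⟩, by omega, ht⟩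
  have hdiag : (((Finset.range N ×ˢ Finset.range N).filter fun p =>
      ∃ t : ℤ, |(p.2 : ℝ) * goldenRatio - p.1 * goldenRatio - t| ≤ r).filter
        fun p => ¬ p.1 ≠ p.2).card = N := by
    have : (((Finset.range N ×ˢ Finset.range N).filter fun p =>
      ∃ t : ℤ, |(p.2 : ℝ) * goldenRatio - p.1 * goldenRatio - t| ≤ r).filter
        fun p => ¬ p.1 ≠ p.2) = (Finset.range N).image fun j => (j, j) := by
      ext ⟨l, m⟩
      simp only [Finset.mem_filter, Finset.mem_product, Finset.mem_range, Finset.mem_image,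
        Prod.mk.injEq, not_not]
      constructor
      · rintro ⟨⟨⟨hl, _⟩, _⟩, rfl⟩
        exact ⟨l, hl, rfl, rfl⟩
      · rintro ⟨j, hj, rfl, rfl⟩
        exact ⟨⟨⟨hj, hj⟩, 0, by simpa using hr⟩, rfl⟩
    rw [this, Finset.card_image_of_injective _ (fun a b h => (Prod.mk.inj h).1),
      Finset.card_range]
  unfold closePairs
  rw [hset, Set.ncard_image_of_injective _ (fun a b h => by
    simp only [Prod.mk.injEq, add_left_inj] at h; exact Prod.ext h.1 h.2),
    Set.ncard_coe_finset]
  conv_lhs => rhs; rw [← hdiag]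
  rw [Finset.card_filter_add_card_filter_not]
  unfold hitCount
  simp only [Finset.card_filter, Finset.sum_product]

theorem abs_closePairs_sub_le {N : ℕ} {r : ℝ} (hr0 : 0 ≤ r) (hr : r < 1 / 2) :
    |(closePairs (kroneckerSeq goldenRatio) N r : ℝ) - 2 * r * N ^ 2| ≤
      -- 10 = 9 + 1, the 1 coming from the diagonal.
      N * (6 * logb 2 N + 10) := by
  have h : (closePairs (kroneckerSeq goldenRatio) N r : ℝ) + N =
      ∑ l ∈ Finset.range N, (hitCount N (l * goldenRatio) r : ℝ) := by
    exact_mod_cast closePairs_add_self (N := N) hr0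
  have hsum : |∑ l ∈ Finset.range N, ((hitCount N (l * goldenRatio) r : ℝ) - 2 * r * N)| ≤
      ∑ _l ∈ Finset.range N, (3 * (2 * logb 2 N + 3)) :=
    (Finset.abs_sum_le_sum_abs _ _).trans
      (Finset.sum_le_sum fun l _ => abs_hitCount_sub_le_log hr0 hr N _)
  rw [Finset.sum_sub_distrib, ← h] at hsum
  simp only [Finset.sum_const, Finset.card_range, nsmul_eq_mul] at hsum
  rw [abs_le] at hsum ⊢
  have : (0 : ℝ) ≤ N := Nat.cast_nonneg N
  constructor <;> nlinarith

theorem hasPairCorrelations_goldenRatio {α : ℝ} (hα0 : 0 < α) (hα1 : α < 1) :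
    HasPairCorrelations α (kroneckerSeq goldenRatio) := by
  intro s hs
  have hβ : 0 < 1 - α := by linarith
  have hlim : Tendsto (fun N : ℕ => (6 * logb 2 N + 10) / (N : ℝ) ^ (1 - α)) atTop (𝓝 0) := by
    have h1 : Tendsto (fun x : ℝ => log x / x ^ (1 - α)) atTop (𝓝 0) :=
      (isLittleO_log_rpow_atTop hβ).tendsto_div_nhds_zero
    have h2 : Tendsto (fun x : ℝ => 10 / x ^ (1 - α)) atTop (𝓝 0) :=
      (tendsto_rpow_atTop hβ).const_div_atTop 10
    have h3 : Tendsto (fun x : ℝ => 6 / log 2 * (log x / x ^ (1 - α)) + 10 / x ^ (1 - α))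
        atTop (𝓝 0) := by
      simpa using (h1.const_mul (6 / log 2)).add h2
    refine (h3.comp tendsto_natCast_atTop_atTop).congr fun N => ?_
    simp only [Function.comp_apply, logb]
    ring
  have hr : Tendsto (fun N : ℕ => s / (N : ℝ) ^ α) atTop (𝓝 0) :=
    ((tendsto_rpow_atTop hα0).const_div_atTop s).comp tendsto_natCast_atTop_atTop
  rw [tendsto_iff_dist_tendsto_zero]
  refine squeeze_zero' (Eventually.of_forall fun _ => dist_nonneg) ?_ hlim
  -- The radius s/N^α drops below 1/2 because α > 0.
  filter_upwards [hr.eventually_lt_const (by norm_num : (0 : ℝ) < 1 / 2), eventually_gt_atTop 0]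
    with N hN hN0
  have hN0' : (0 : ℝ) < N := by exact_mod_cast hN0
  have h := abs_closePairs_sub_le (N := N) (by positivity) hN
  have hpos : (0 : ℝ) < (N : ℝ) ^ (2 - α) := by positivity
  have e1 : (N : ℝ) ^ (2 - α) = N * (N : ℝ) ^ (1 - α) := by
    rw [show 2 - α = 1 + (1 - α) by ring, rpow_add hN0', rpow_one]
  have e2 : 2 * (s / (N : ℝ) ^ α) * N ^ 2 = 2 * s * (N : ℝ) ^ (2 - α) := by
    rw [rpow_sub hN0', rpow_two]
    ring
  rw [e2] at h
  have e3 : pairCorrelation (kroneckerSeq goldenRatio) α N s - 2 * s =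
      ((closePairs (kroneckerSeq goldenRatio) N (s / (N : ℝ) ^ α) : ℝ)
        - 2 * s * (N : ℝ) ^ (2 - α)) / (N : ℝ) ^ (2 - α) := by
    unfold pairCorrelation
    field_simp
  rw [dist_eq, e3, abs_div, abs_of_pos hpos]
  calc _ ≤ (N * (6 * logb 2 N + 10)) / (N : ℝ) ^ (2 - α) :=
        div_le_div_of_nonneg_right h hpos.le
    _ = _ := by rw [e1, mul_div_mul_left _ _ hN0'.ne']

theorem not_hasPoissonianPairCorrelations_goldenRatio :
    ¬ HasPoissonianPairCorrelations (kroneckerSeq goldenRatio) := by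
  intro h
  -- Starting at F_2 avoids the repetition F_1 = F_2.
  have hfib : Tendsto (fun k : ℕ => Nat.fib (k + 2)) atTop atTop :=
    Nat.fib_add_two_strictMono.tendsto_atTop
  have h1 := (h (1 / 2) (by norm_num)).comp hfib
  have h2 : Tendsto (fun _ : ℕ => (0 : ℝ)) atTop (𝓝 (2 * (1 / 2))) := by
    refine h1.congr fun k => ?_
    have := pairCorrelation_one_fib (k + 1)
    unfold pairCorrelation at this
    rwa [rpow_one, show (2 : ℝ) - 1 = 1 by norm_num, rpow_one] at this
  have := tendsto_nhds_unique h2 tendsto_const_nhds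
  norm_num at this

end PairCorrelations

/-- Denominators are indexed from 0: `h` here stands for q_{h+1}. -/
theorem theorem7 :
    (∀ α : ℝ, 0 < α → α < 1 → HasPairCorrelations α (kroneckerSeq Real.goldenRatio)) ∧
    ¬ HasPoissonianPairCorrelations (kroneckerSeq Real.goldenRatio) ∧
    (∀ h : ℕ,
      (GenContFract.of Real.goldenRatio).dens h = (Nat.fib (h + 1) : ℝ) ∧
      (∀ l m : ℕ, 1 ≤ l → l ≤ Nat.fib (h + 1) → 1 ≤ m → m ≤ Nat.fib (h + 1) → l ≠ m →
        1 / (2 * (Nat.fib (h + 1) : ℝ)) <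
          circleNorm (kroneckerSeq Real.goldenRatio l - kroneckerSeq Real.goldenRatio m)) ∧
      pairCorrelation (kroneckerSeq Real.goldenRatio) 1 (Nat.fib (h + 1)) (1 / 2) = 0) := by
  refine ⟨fun α h0 h1 => hasPairCorrelations_goldenRatio h0 h1,
    not_hasPoissonianPairCorrelations_goldenRatio, fun h => ⟨dens_goldenRatio h, ?_,
      pairCorrelation_one_fib h⟩⟩
  intro l m hl1 hl hm1 hm hlm
  exact one_div_two_mul_fib_lt_circleNorm hl1 hl hm1 hm hlm
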